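/- \textbf{The game.} Let $G$ be a finite simple graph. \emph{Cops and Cheating Robot} with $k$ cops is played on $G$ as follows. First the $k$ cops are placed on vertices (several cops may share a vertex), then the robber ("Robert") is placed on a vertex not occupied by a cop. Afterwards the cops and Robert move alternately, the cops first, with full information: in her turn each cop stays where she is or moves to an adjacent vertex, and then Robert stays where he is or moves to an adjacent vertex. The cops win as soon as Robert ends his turn on a vertex occupied by a cop, or Robert traverses an edge that was traversed by a cop on the cops' immediately preceding move. (A cop moving onto Robert's vertex does not by itself end the game.) The \emph{cheating robot number} $c_{cr}(G)$ is the least $k$ for which $k$ cops have a strategy (a choice of starting vertices and of moves, depending on the play so far) such that, however Robert plays, the cops win after finitely many turns. The \emph{strong product} $G\boxtimes H$ has vertex set $V(G)\times V(H)$, and distinct vertices $(u,v)$ and $(x,y)$ are adjacent if and only if ($u=x$ or $ux\in E(G)$) and ($v=y$ or $vy\in E(H)$). Let $P_n$, $C_n$ and $K_n$ denote the path, the cycle and the complete graph on $n$ vertices. \textbf{Theorem.} For all integers $n,m\ge 3$ and $r,s\ge 2$, $$c_{cr}(C_n\boxtimes P_s)=5,\qquad c_{cr}(C_n\boxtimes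 C_m)=8,$$ $$c_{cr}(K_r\boxtimes P_s)=2r-1,\qquad c_{cr}(K_r\boxtimes C_m)=3r-1,\qquad c_{cr}(K_r\boxtimes K_s)=rs-1.$$ -/

import Mathlib

/-- The strong product `G ⊠ H` of two simple graphs. -/
def strongProd {V W : Type*} (G : SimpleGraph V) (H : SimpleGraph W) :
    SimpleGraph (V × W) where
  Adj p q :=
    (G.Adj p.1 q.1 ∧ p.2 = q.2) ∨ (p.1 = q.1 ∧ H.Adj p.2 q.2) ∨
      (G.Adj p.1 q.1 ∧ H.Adj p.2 q.2)
  symm := ⟨by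
    rintro p q (⟨h, e⟩ | ⟨e, h⟩ | ⟨h, h'⟩)
    · exact Or.inl ⟨h.symm, e.symm⟩
    · exact Or.inr (Or.inl ⟨e.symm, h.symm⟩)
    · exact Or.inr (Or.inr ⟨h.symm, h'.symm⟩)⟩
  loopless := ⟨by
    rintro p (⟨h, -⟩ | ⟨-, h⟩ | ⟨h, -⟩)
    · exact G.loopless.irrefl _ h
    · exact H.loopless.irrefl _ h
    · exact G.loopless.irrefl _ h⟩

infixl:70 " ⊠ " => strongProd

namespace CheatingRobot

variable {V : Type*} (G : SimpleGraph V)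

/-- A legal move of one player: stay, or move along an edge. -/
def Step (u v : V) : Prop := u = v ∨ G.Adj u v

/-- A strategy for `k` cops.  The argument of `pos` is the list of all positions Robert has held
so far, most recent first: `pos []` is the starting position of the cops, and
`pos [r t, …, r 1, r 0]` is their position after their move number `t + 1`, chosen after seeing
Robert's positions `r 0, …, r t`. Several cops may share a vertex. -/
structure CopStrategy (k : ℕ) where
  pos : List V → Fin k → V
  legal : ∀ (h : List V) (v : V) (i : Fin k), Step G (pos h i) (pos (v :: h) i)

/-- The positions `[r (t - 1), …, r 1, r 0]`, most recent first. -/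
def history (r : ℕ → V) : ℕ → List V
  | 0 => []
  | t + 1 => r t :: history r t

variable {G}

/-- The positions of the cops after `t` moves, when Robert's positions are `r 0, r 1, …`. -/
def CopStrategy.copsAt {k : ℕ} (S : CopStrategy G k) (r : ℕ → V) (t : ℕ) : Fin k → V :=
  S.pos (history r t)

/-- `r 0, r 1, …` is a legal way for Robert to play against `S`: he starts on a vertex without
a cop, and then makes legal moves. -/
def CopStrategy.LegalPlay {k : ℕ} (S : CopStrategy G k) (r : ℕ → V) : Prop :=
  (∀ i, S.copsAt r 0 i ≠ r 0) ∧ ∀ t, Step G (r t) (r (t + 1))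

/-- In the round in which the cops move from `c` to `c'` and then Robert moves from `v` to `v'`,
Robert is captured: he ends his turn on a vertex occupied by a cop, or he traverses an edge that
a cop has traversed on her move immediately before. -/
def Captured {k : ℕ} (c c' : Fin k → V) (v v' : V) : Prop :=
  (∃ i, c' i = v') ∨ (v ≠ v' ∧ ∃ i, s(c i, c' i) = s(v, v'))

/-- `S` is a winning strategy: however Robert plays, he is captured after finitely many rounds. -/
def CopStrategy.IsWinning {k : ℕ} (S : CopStrategy G k) : Prop :=
  ∀ r : ℕ → V, S.LegalPlay r →
    ∃ t, Captured (S.copsAt r t) (S.copsAt r (t + 1)) (r t) (r (t + 1))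

/-- The cheating robot number: the fewest number of cops that have a winning strategy. -/
noncomputable def cheatingRobotNumber (G : SimpleGraph V) : ℕ :=
  sInf {k : ℕ | ∃ S : CopStrategy G k, S.IsWinning}

end CheatingRobot

/-! Lower bound: besides Robert's own vertex, each cop blocks at most one vertex of his closed
neighbourhood, so fewer than `d - 1` cops never catch him when all closed neighbourhoods have at
least `d` elements (`ClosedNbhdCard.le_of_isWinning`). These bounds `d` multiply in strong products;
they are 2 for paths, 3 for cycles and `r` for `K_r`.

Upper bound on `G ⊠ H`, seen as copies of `G` (rows) indexed by a path `H`: `d` guards in a row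
stand on shadows of Robert covering every vertex of `G` that he can reach in one move, so he cannot
enter that row. A free team of `d - 1` cops, which wins on `G`, plays against him in the next row;
he is caught or moves further up, and the guards advance. This takes `2 * d - 1` cops. If `H` is a
cycle, `d` more guards keep him out of row 0, which reduces the cycle to a path and takes `3 * d -
1` cops. The argument is `Layout.wins_of_guarded`; `Layout.wins_of_row_zero` brings the guards into
place. For `K_r ⊠ K_s` a direct two-move win suffices. -/

namespace CheatingRobot

/-! ### Winning positions and strategies -/

section Basic

variable {V W : Type*}

theorem Step.refl (G : SimpleGraph V) (v : V) : Step G v v := Or.inl rfl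

theorem step_strongProd {G : SimpleGraph V} {H : SimpleGraph W} {p q : V × W} :
    Step (G ⊠ H) p q ↔ Step G p.1 q.1 ∧ Step H p.2 q.2 := by
  simp only [Step, strongProd, Prod.ext_iff]
  tauto

/-- `Captured`, for cops indexed by an arbitrary type. -/
def Caught {ι : Type*} (c c' : ι → V) (v v' : V) : Prop :=
  (∃ i, c' i = v') ∨ (v ≠ v' ∧ ∃ i, s(c i, c' i) = s(v, v'))

/-- Used for captures of a shadow, which do not end the real game: they still leave some cop within
one step of the shadow, as a guard must be. -/
theorem Caught.exists_step {ι : Type*} {G : SimpleGraph V} {c c' : ι → V} {v v' : V}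
    (h : Caught c c' v v') (hs : Step G v v') : ∃ i, Step G (c' i) v' := by
  rcases h with ⟨i, hi⟩ | ⟨-, i, hi⟩
  · exact ⟨i, Or.inl hi⟩
  · refine ⟨i, ?_⟩
    rcases Sym2.eq_iff.mp hi with ⟨-, h⟩ | ⟨-, h⟩
    · exact Or.inl h
    · rw [h]
      exact hs

/-- The cops, to move, can capture Robert within `n` rounds from the positions `c` and `v`. -/
def WinsIn {ι : Type*} (G : SimpleGraph V) : ℕ → (ι → V) → V → Prop
  | 0 => fun _ _ => False
  | n + 1 => fun c v => ∃ c' : ι → V, (∀ i, Step G (c i) (c' i)) ∧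
      ∀ v', Step G v v' → ¬ Caught c c' v v' → WinsIn G n c' v'

/-- The cops, to move, can capture Robert from the positions `c` and `v`. -/
def Wins {ι : Type*} (G : SimpleGraph V) (c : ι → V) (v : V) : Prop := ∃ n, WinsIn G n c v

theorem WinsIn.succ {ι : Type*} {G : SimpleGraph V} {n : ℕ} :
    ∀ {c : ι → V} {v : V}, WinsIn G n c v → WinsIn G (n + 1) c v := by
  induction n with
  | zero => exact fun h => h.elim
  | succ n ih =>
    rintro c v ⟨c', hc, h⟩
    exact ⟨c', hc, fun v' hv hn => ih (h v' hv hn)⟩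

theorem WinsIn.mono {ι : Type*} {G : SimpleGraph V} {m n : ℕ} (hmn : m ≤ n) {c : ι → V} {v : V}
    (h : WinsIn G m c v) : WinsIn G n c v := by
  induction hmn with
  | refl => exact h
  | step _ ih => exact ih.succ

/-- Robert has finitely many answers, so the bounds on the number of rounds after each of them have
a common maximum. -/
theorem Wins.intro [Finite V] {ι : Type*} {G : SimpleGraph V} {c : ι → V} {v : V} (c' : ι → V)
    (hc : ∀ i, Step G (c i) (c' i))
    (h : ∀ v', Step G v v' → ¬ Caught c c' v v' → Wins G c' v') : Wins G c v := by
  classical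
  have := Fintype.ofFinite V
  have h' : ∀ v', ∃ n, Step G v v' → ¬ Caught c c' v v' → WinsIn G n c' v' := fun v' => by
    by_cases hv : Step G v v' ∧ ¬ Caught c c' v v'
    · obtain ⟨n, hn⟩ := h v' hv.1 hv.2
      exact ⟨n, fun _ _ => hn⟩
    · exact ⟨0, fun h1 h2 => (hv ⟨h1, h2⟩).elim⟩
  choose N hN using h'
  exact ⟨Finset.univ.sup N + 1, c', hc, fun v' h1 h2 =>
    (hN v' h1 h2).mono (Finset.le_sup (f := N) (Finset.mem_univ v'))⟩

theorem Wins.reindex {ι κ : Type*} {G : SimpleGraph V} (e : ι ≃ κ) {c : κ → V} {v : V}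
    (h : Wins G (c ∘ e) v) : Wins G c v := by
  obtain ⟨n, hn⟩ := h
  refine ⟨n, ?_⟩
  induction n generalizing c v with
  | zero => exact hn
  | succ n ih =>
    obtain ⟨c', hc, h⟩ := hn
    refine ⟨c' ∘ e.symm, fun i => by simpa using hc (e.symm i), fun v' hv hn => ?_⟩
    refine ih ?_
    have he : (c' ∘ e.symm) ∘ e = c' := by ext; simp
    rw [he]
    refine h v' hv fun hcap => hn ?_
    rcases hcap with ⟨i, hi⟩ | ⟨hne, i, hi⟩
    · exact Or.inl ⟨e i, by simpa using hi⟩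
    · exact Or.inr ⟨hne, e i, by simpa using hi⟩

theorem exists_isWinning {G : SimpleGraph V} {k : ℕ} (c₀ : Fin k → V)
    (h : ∀ v, Wins G c₀ v) : ∃ S : CopStrategy G k, S.IsWinning := by
  classical
  have hmove : ∀ (c : Fin k → V) (v : V), ∃ c' : Fin k → V, (∀ i, Step G (c i) (c' i)) ∧
      ∀ n, WinsIn G (n + 1) c v →
        ∀ v', Step G v v' → ¬ Caught c c' v v' → WinsIn G n c' v' := by
    intro c v
    by_cases hw : ∃ n, WinsIn G n c v
    -- A move from a shortest win serves every `n` at once, by monotonicity in `n`.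
    · have hs := Nat.find_spec hw
      obtain ⟨m, hm⟩ : ∃ m, Nat.find hw = m + 1 := by
        refine Nat.exists_eq_succ_of_ne_zero fun h0 => ?_
        rw [h0] at hs
        exact hs
      rw [hm] at hs
      obtain ⟨c', hc, h'⟩ := hs
      refine ⟨c', hc, fun n hn v' h1 h2 => (h' v' h1 h2).mono ?_⟩
      have := Nat.find_min' hw hn
      omega
    · exact ⟨c, fun i => Step.refl G _, fun n hn => (hw ⟨_, hn⟩).elim⟩
  choose f hf hwin using hmove
  let pos : List V → Fin k → V := fun l => List.rec c₀ (fun v _ c => f c v) l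
  refine ⟨⟨pos, fun l v i => hf _ _ i⟩, fun r hr => ?_⟩
  set S : CopStrategy G k := ⟨pos, fun l v i => hf _ _ i⟩ with hS
  have key : ∀ n t, WinsIn G n (S.copsAt r t) (r t) →
      ∃ t, Captured (S.copsAt r t) (S.copsAt r (t + 1)) (r t) (r (t + 1)) := by
    intro n
    induction n with
    | zero => exact fun t ht => ht.elim
    | succ n ih =>
      intro t ht
      by_cases hcap : Captured (S.copsAt r t) (S.copsAt r (t + 1)) (r t) (r (t + 1))
      · exact ⟨t, hcap⟩
      · exact ih (t + 1) (hwin _ _ n ht _ (hr.2 t) hcap)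
  obtain ⟨n, hn⟩ := h (r 0)
  exact key n 0 hn

theorem exists_isWinning_of_card {ι : Type*} [Fintype ι] {G : SimpleGraph V} {k : ℕ}
    (hk : Fintype.card ι = k) (c₀ : ι → V) (h : ∀ v, Wins G c₀ v) :
    ∃ S : CopStrategy G k, S.IsWinning := by
  let e := Fintype.equivFinOfCardEq hk
  refine exists_isWinning (c₀ ∘ e.symm) fun v => Wins.reindex e ?_
  have : (c₀ ∘ e.symm) ∘ e = c₀ := by ext; simp
  rw [this]
  exact h v

end Basic

/-! ### Lower bound from closed neighbourhoods -/

section LowerBound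

variable {V W : Type*}

/-- Every closed neighbourhood has at least `d` elements. -/
def ClosedNbhdCard (G : SimpleGraph V) (d : ℕ) : Prop :=
  ∀ v, ∃ A : Finset V, d ≤ A.card ∧ ∀ x ∈ A, Step G v x

theorem ClosedNbhdCard.strongProd {G : SimpleGraph V} {H : SimpleGraph W} {d e : ℕ}
    (hG : ClosedNbhdCard G d) (hH : ClosedNbhdCard H e) : ClosedNbhdCard (G ⊠ H) (d * e) := by
  intro p
  obtain ⟨A, hA, hA'⟩ := hG p.1
  obtain ⟨B, hB, hB'⟩ := hH p.2
  refine ⟨A ×ˢ B, ?_, fun x hx => ?_⟩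
  · rw [Finset.card_product]
    exact Nat.mul_le_mul hA hB
  · rw [Finset.mem_product] at hx
    exact step_strongProd.mpr ⟨hA' _ hx.1, hB' _ hx.2⟩

/-- A cop blocks at most one of the neighbours of Robert's vertex. -/
theorem ClosedNbhdCard.exists_escape {G : SimpleGraph V} {d k : ℕ} (hG : ClosedNbhdCard G d)
    (hk : k + 1 < d) (c c' : Fin k → V) (v : V) :
    ∃ v', Step G v v' ∧ ¬ Captured c c' v v' := by
  classical
  obtain ⟨A, hA, hA'⟩ := hG v
  by_contra! hcap
  -- A cop ending on `v` blocks only the edge to the vertex she came from; any other cop blocks only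
  -- the vertex she ends on.
  have hsub : A ⊆ insert v (Finset.univ.image fun i => if c' i = v then c i else c' i) := by
    intro w hw
    rw [Finset.mem_insert, Finset.mem_image]
    by_cases hwv : w = v
    · exact Or.inl hwv
    · right
      rcases hcap w (hA' w hw) with ⟨i, hi⟩ | ⟨-, i, hi⟩
      · exact ⟨i, Finset.mem_univ i, by rw [if_neg (by rw [hi]; exact hwv), hi]⟩
      · refine ⟨i, Finset.mem_univ i, ?_⟩
        rcases Sym2.eq_iff.mp hi with ⟨-, h2⟩ | ⟨h1, h2⟩
        · rw [if_neg (by rw [h2]; exact hwv), h2]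
        · rw [if_pos h2, h1]
  have h1 := Finset.card_le_card hsub
  have h2 := Finset.card_insert_le v
    (Finset.univ.image fun i => if c' i = v then c i else c' i)
  have h3 := Finset.card_image_le (s := (Finset.univ : Finset (Fin k)))
    (f := fun i => if c' i = v then c i else c' i)
  rw [Finset.card_univ, Fintype.card_fin] at h3
  omega

theorem ClosedNbhdCard.le_of_isWinning [Nonempty V] {G : SimpleGraph V} {d k : ℕ}
    (hG : ClosedNbhdCard G d) (S : CopStrategy G k) (hS : S.IsWinning) : d - 1 ≤ k := by
  classical
  by_contra! hlt
  have hk : k + 1 < d := by omega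
  -- An escape from cops who stand still is a vertex that no cop occupies.
  obtain ⟨v₀, hv₀⟩ : ∃ v, ∀ i, S.pos [] i ≠ v := by
    obtain ⟨v⟩ := ‹Nonempty V›
    obtain ⟨w, -, hw⟩ := hG.exists_escape hk (S.pos []) (S.pos []) v
    exact ⟨w, fun i hi => hw (Or.inl ⟨i, hi⟩)⟩
  have hnext : ∀ l : List V, ∀ v : V, ∃ v', Step G v v' ∧
      ¬ Captured (S.pos l) (S.pos (v :: l)) v v' := fun l v => hG.exists_escape hk _ _ v
  choose f hf hf' using hnext
  -- Robert's answer depends on his past positions, so these are built along with the current one.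
  let st : ℕ → List V × V := fun t =>
    Nat.rec ([], v₀) (fun _ q => (q.2 :: q.1, f q.1 q.2)) t
  have hhist : ∀ t, history (fun t => (st t).2) t = (st t).1 := by
    intro t
    induction t with
    | zero => rfl
    | succ t ih =>
      rw [history, ih]
  obtain ⟨t, ht⟩ := hS (fun t => (st t).2) ⟨hv₀, fun t => hf (st t).1 (st t).2⟩
  rw [CopStrategy.copsAt, CopStrategy.copsAt, hhist, hhist] at ht
  exact hf' (st t).1 (st t).2 ht

theorem cheatingRobotNumber_eq [Nonempty V] {G : SimpleGraph V} {d : ℕ} (hG : ClosedNbhdCard G d)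
    (h : ∃ S : CopStrategy G (d - 1), S.IsWinning) : cheatingRobotNumber G = d - 1 :=
  le_antisymm (Nat.sInf_le h)
    (le_csInf ⟨_, h⟩ fun _ ⟨S, hS⟩ => hG.le_of_isWinning S hS)

end LowerBound

/-! ### Cops winning on complete graphs and cycles -/

section CompleteAndCycle

/-- The cops occupy every vertex except Robert's, so he has to stay. Then all of them move onto his
vertex: staying is fatal, and every edge he could leave by has just been traversed. -/
theorem wins_of_forall_step {V κ : Type*} [Fintype V] [Fintype κ] {G : SimpleGraph V}
    (hG : ∀ u v, Step G u v) [Nonempty κ]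
    (hcard : Fintype.card κ + 1 = Fintype.card V) (c : κ → V) (v : V) :
    Wins G c v := by
  classical
  have e : κ ≃ {x : V // x ≠ v} := Fintype.equivOfCardEq (by
    rw [Fintype.card_subtype_compl, Fintype.card_subtype_eq]
    omega)
  refine Wins.intro (fun i => (e i : V)) (fun i => hG _ _) fun v' _ hn => ?_
  have hv : v' = v := by
    by_contra hne
    exact hn (Or.inl ⟨e.symm ⟨v', hne⟩, by simp⟩)
  subst hv
  refine Wins.intro (fun _ => v') (fun i => hG _ _) fun w _ hn => (hn ?_).elim
  by_cases hw : w = v'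
  · subst hw
    exact Or.inl ⟨Classical.arbitrary κ, rfl⟩
  · exact Or.inr ⟨Ne.symm hw, e.symm ⟨w, hw⟩, by simp [Sym2.eq_swap]⟩

theorem step_cycleGraph {n : ℕ} {u v : Fin (n + 3)} :
    Step (SimpleGraph.cycleGraph (n + 3)) u v ↔ u.val = v.val ∨ u.val + 1 = v.val ∨
      v.val + 1 = u.val ∨ (u.val = 0 ∧ v.val = n + 2) ∨ (v.val = 0 ∧ u.val = n + 2) := by
  rw [Step, SimpleGraph.cycleGraph_adj', Fin.ext_iff]
  have hu := u.isLt
  have hv := v.isLt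
  rcases lt_trichotomy u v with h | h | h
  · rw [Fin.coe_sub_iff_lt.mpr h, Fin.coe_sub_iff_le.mpr h.le]
    have h' : u.val < v.val := h
    omega
  · subst h
    simp
  · rw [Fin.coe_sub_iff_lt.mpr h, Fin.coe_sub_iff_le.mpr h.le]
    have h' : v.val < u.val := h
    omega

/-- The cop at 0 cuts the cycle into a path. The other cop approaches along it and Robert cannot get
past her, as crossing her edge is a capture; so the stretch left to him shrinks. -/
theorem wins_cycleGraph_of_lt {n : ℕ} (d : ℕ) : ∀ (c : Fin 2 → Fin (n + 3)) (v : Fin (n + 3)),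
    (c 0).val = 0 → (c 1).val < v.val → n + 3 - (c 1).val ≤ d →
      Wins (SimpleGraph.cycleGraph (n + 3)) c v := by
  induction d with
  | zero =>
    intro c v _ _ h
    omega
  | succ d ih =>
    intro c v h0 hlt hd
    have hv := v.isLt
    let x : Fin (n + 3) := ⟨(c 1).val + 1, by omega⟩
    have hx : x.val = (c 1).val + 1 := rfl
    refine Wins.intro ![c 0, x] ?_ fun v' hs hn => ih _ _ h0 ?_ ?_
    · intro i
      fin_cases i
      · exact Step.refl _ _
      · exact step_cycleGraph.mpr (Or.inr (Or.inl rfl))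
    · have h1 : v' ≠ c 0 := fun h => hn (Or.inl ⟨0, h.symm⟩)
      have h2 : v' ≠ x := fun h => hn (Or.inl ⟨1, h.symm⟩)
      have h3 : ¬ (v = x ∧ v' = c 1) := fun h => by
        refine hn (Or.inr ⟨fun he => h2 (he ▸ h.1), 1, ?_⟩)
        rw [h.1, h.2, Sym2.eq_swap]
        rfl
      rw [step_cycleGraph] at hs
      simp only [ne_eq, Fin.ext_iff] at h1 h2 h3
      show x.val < v'.val
      omega
    · show n + 3 - x.val ≤ d
      omega

theorem wins_cycleGraph_of_gt {n : ℕ} (d : ℕ) : ∀ (c : Fin 2 → Fin (n + 3)) (v : Fin (n + 3)),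
    (c 0).val = 0 → v.val < (c 1).val → v.val ≠ 0 → (c 1).val ≤ d →
      Wins (SimpleGraph.cycleGraph (n + 3)) c v := by
  induction d with
  | zero =>
    intro c v _ _ _ h
    omega
  | succ d ih =>
    intro c v h0 hlt hv0 hd
    have hc := (c 1).isLt
    let x : Fin (n + 3) := ⟨(c 1).val - 1, by omega⟩
    have hx : x.val = (c 1).val - 1 := rfl
    refine Wins.intro ![c 0, x] ?_ fun v' hs hn => ?_
    · intro i
      fin_cases i
      · exact Step.refl _ _
      · exact step_cycleGraph.mpr (Or.inr (Or.inr (Or.inl (by simp; omega))))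
    · have h1 : v' ≠ c 0 := fun h => hn (Or.inl ⟨0, h.symm⟩)
      have h2 : v' ≠ x := fun h => hn (Or.inl ⟨1, h.symm⟩)
      have h3 : ¬ (v = x ∧ v' = c 1) := fun h => by
        refine hn (Or.inr ⟨fun he => h2 (he ▸ h.1), 1, ?_⟩)
        rw [h.1, h.2, Sym2.eq_swap]
        rfl
      rw [step_cycleGraph] at hs
      simp only [ne_eq, Fin.ext_iff] at h1 h2 h3
      refine ih _ _ h0 ?_ (by omega) ?_
      · show v'.val < x.val
        omega
      · show x.val ≤ d
        omega

/-- Two cops win on a cycle: one of them waits at the vertex `0`, the other one chases Robert. -/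
theorem wins_cycleGraph {n : ℕ} (c : Fin 2 → Fin (n + 3)) (v : Fin (n + 3)) :
    Wins (SimpleGraph.cycleGraph (n + 3)) c v := by
  have key : ∀ (d : ℕ) (c : Fin 2 → Fin (n + 3)) (v : Fin (n + 3)), (c 0).val ≤ d →
      Wins (SimpleGraph.cycleGraph (n + 3)) c v := by
    intro d
    induction d with
    | zero =>
      intro c v h0
      -- Robert may share a vertex with a cop; passing one turn forces him off.
      refine Wins.intro c (fun i => Step.refl _ _) fun v' _ hn => ?_
      have h1 : v' ≠ c 0 := fun h => hn (Or.inl ⟨0, h.symm⟩)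
      have h2 : v' ≠ c 1 := fun h => hn (Or.inl ⟨1, h.symm⟩)
      simp only [ne_eq, Fin.ext_iff] at h1 h2
      rcases lt_or_gt_of_ne h2 with h | h
      · exact wins_cycleGraph_of_gt _ c v' (by omega) h (by omega) le_rfl
      · exact wins_cycleGraph_of_lt _ c v' (by omega) h le_rfl
    | succ d ih =>
      intro c v h0
      have hc := (c 0).isLt
      let x : Fin (n + 3) := ⟨(c 0).val - 1, by omega⟩
      refine Wins.intro ![x, c 1] ?_ fun v' _ _ => ih _ _ ?_
      · intro i
        fin_cases i
        · refine step_cycleGraph.mpr ?_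
          simp [x]
          omega
        · exact Step.refl _ _
      · show (c 0).val - 1 ≤ d
        omega
  exact key _ c v le_rfl

end CompleteAndCycle

/-! ### The guarding strategy on strong products -/

section Product

variable {V Q R κ : Type*} {L : ℕ} {G : SimpleGraph V} {H : SimpleGraph (Fin L)}

/-- Shadows of a vertex of `G`: they move legally whenever the vertex does. -/
def Equivariant (G : SimpleGraph V) (g : Q → V → V) : Prop :=
  ∀ q a a', Step G a a' → Step G (g q a) (g q a')

/-- Among the shadows of each vertex are all vertices in its closed neighbourhood. -/
def Covers (G : SimpleGraph V) (g : Q → V → V) : Prop :=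
  ∀ a a', Step G a a' → ∃ q, g q a = a'

/-- The hypotheses on `G` and `H` under which the cops win on `G ⊠ H`. The graph `H` is a path,
with further edges at the vertex `0` if the shadows `h` guard that row. -/
structure Layout (G : SimpleGraph V) (H : SimpleGraph (Fin L)) (g : Q → V → V) (h : R → V → V)
    (κ : Type*) : Prop where
  wins : ∀ (c : κ → V) v, Wins G c v
  equivariant_lower : Equivariant G g
  equivariant_wall : Equivariant G h
  covers_lower : Covers G g
  step_succ : ∀ i j : Fin L, i.val + 1 = j.val → Step H i j
  step_imp : ∀ i j : Fin L, Step H i j →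
    (j.val ≤ i.val + 1 ∧ i.val ≤ j.val + 1) ∨ ((i.val = 0 ∨ j.val = 0) ∧ Covers G h)

variable {g : Q → V → V} {h : R → V → V}

/-- The cops are about to move, the shadow guards can step to the current shadows in the rows `j`
and `0`, and Robert is above the row `j`. -/
structure Guarded (G : SimpleGraph V) (g : Q → V → V) (h : R → V → V) (j : Fin L)
    (c : (Q ⊕ R) ⊕ κ → V × Fin L) (v : V × Fin L) : Prop where
  lower : ∀ q, Step G (c (.inl (.inl q))).1 (g q v.1) ∧ (c (.inl (.inl q))).2 = j
  wall : ∀ q, Step G (c (.inl (.inr q))).1 (h q v.1) ∧ (c (.inl (.inr q))).2.val = 0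
  above : j < v.2

/-- The move of the cops with the guards on the shadows, in the rows `i` and `z`. -/
def guardMove (g : Q → V → V) (h : R → V → V) (i z : Fin L) (y : κ → V × Fin L) (a : V) :
    (Q ⊕ R) ⊕ κ → V × Fin L :=
  Sum.elim (Sum.elim (fun q => (g q a, i)) (fun q => (h q a, z))) y

theorem Guarded.legal {j i z : Fin L} {c : (Q ⊕ R) ⊕ κ → V × Fin L} {v : V × Fin L}
    (hP : Guarded G g h j c v) (hi : Step H j i) (hz : z.val = 0) {y : κ → V × Fin L}
    (hy : ∀ k, Step (G ⊠ H) (c (.inr k)) (y k)) :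
    ∀ k, Step (G ⊠ H) (c k) (guardMove g h i z y v.1 k) := by
  rintro ((q | q) | k)
  · refine step_strongProd.mpr ⟨(hP.lower q).1, ?_⟩
    rw [(hP.lower q).2]
    exact hi
  · refine step_strongProd.mpr ⟨(hP.wall q).1, Or.inl (Fin.ext ?_)⟩
    rw [(hP.wall q).2]
    exact hz.symm
  · exact hy k

/-- A guarded row has a guard on every vertex Robert could enter it by. Without edges around row 0
he can therefore not get from above row `i` to below it. -/
theorem Layout.guarded_guardMove (hL : Layout G H g h κ) {i z : Fin L}
    {c : (Q ⊕ R) ⊕ κ → V × Fin L} {v v' : V × Fin L} (hz : z.val = 0) (hi : i < v.2)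
    {y : κ → V × Fin L} (hs : Step (G ⊠ H) v v')
    (hn : ¬ Caught c (guardMove g h i z y v.1) v v') :
    Guarded G g h i (guardMove g h i z y v.1) v' := by
  rw [step_strongProd] at hs
  refine ⟨fun q => ⟨hL.equivariant_lower q _ _ hs.1, rfl⟩,
    fun q => ⟨hL.equivariant_wall q _ _ hs.1, hz⟩, ?_⟩
  have h1 : v'.2 ≠ i := fun he => by
    obtain ⟨q, hq⟩ := hL.covers_lower _ _ hs.1
    exact hn (Or.inl ⟨.inl (.inl q), Prod.ext hq he.symm⟩)
  have h2 : Covers G h → v'.2 ≠ z := fun hc he => by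
    obtain ⟨q, hq⟩ := hc _ _ hs.1
    exact hn (Or.inl ⟨.inl (.inr q), Prod.ext hq he.symm⟩)
  rw [Fin.lt_def] at hi ⊢
  rw [ne_eq, Fin.ext_iff] at h1
  rcases hL.step_imp _ _ hs.2 with h3 | ⟨h3, h4⟩
  · omega
  · have h5 := h2 h4
    rw [ne_eq, Fin.ext_iff] at h5
    omega

/-- Induction on the number of rows from `j` upwards. The free cops gather in row `j + 1` and
respond there while Robert is in it. Once he is higher, the guards step up and onto his shadows in a
single move, which the strong product allows. -/
theorem Layout.wins_of_guarded [Finite V] (hL : Layout G H g h κ) (d : ℕ) : ∀ (j : Fin L)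
    (c : (Q ⊕ R) ⊕ κ → V × Fin L) (v : V × Fin L), L - j.val ≤ d → Guarded G g h j c v →
    (∀ k, (c (.inr k)).2 = j ∨ (c (.inr k)).2.val = j.val + 1) → Wins (G ⊠ H) c v := by
  induction d with
  | zero =>
    intro j c v hd
    have := j.isLt
    omega
  | succ d ih =>
    intro j c v hd hP hk
    let z : Fin L := ⟨0, by have := j.isLt; omega⟩
    have hj : j.val + 1 < L := by
      have h1 := hP.above
      have h2 := v.2.isLt
      rw [Fin.lt_def] at h1
      omega
    let j' : Fin L := ⟨j.val + 1, hj⟩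
    have hstep : Step H j j' := hL.step_succ _ _ rfl
    have hk' : ∀ {c : (Q ⊕ R) ⊕ κ → V × Fin L},
        (∀ k, (c (.inr k)).2 = j ∨ (c (.inr k)).2.val = j.val + 1) →
        ∀ k, Step (G ⊠ H) (c (.inr k)) ((c (.inr k)).1, j') := fun {c} hk k => by
      refine step_strongProd.mpr ⟨Step.refl G _, ?_⟩
      rcases hk k with h1 | h1
      · rw [h1]
        exact hstep
      · exact Or.inl (Fin.ext h1)
    have advance : ∀ (c : (Q ⊕ R) ⊕ κ → V × Fin L) (v : V × Fin L), Guarded G g h j c v →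
        (∀ k, (c (.inr k)).2 = j ∨ (c (.inr k)).2.val = j.val + 1) → v.2 ≠ j' →
        Wins (G ⊠ H) c v := by
      intro c v hP hk hne
      refine Wins.intro (guardMove g h j' z (fun k => ((c (.inr k)).1, j')) v.1)
        (hP.legal hstep rfl (hk' hk)) fun v' hs hn => ?_
      refine ih j' _ _ ?_ (hL.guarded_guardMove rfl ?_ hs hn) fun k => Or.inl rfl
      · show L - (j.val + 1) ≤ d
        omega
      · have h1 := hP.above
        rw [Fin.lt_def] at h1 ⊢
        rw [ne_eq, Fin.ext_iff] at hne
        have h2 : j'.val = j.val + 1 := rfl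
        omega
    have play : ∀ (n : ℕ) (c : (Q ⊕ R) ⊕ κ → V × Fin L) (v : V × Fin L), Guarded G g h j c v →
        (∀ k, (c (.inr k)).2 = j') → WinsIn G n (fun k => (c (.inr k)).1) v.1 →
        Wins (G ⊠ H) c v := by
      intro n
      induction n with
      | zero => exact fun c v _ _ hw => hw.elim
      | succ n ihn =>
        intro c v hP hk hw
        by_cases hv : v.2 = j'
        · obtain ⟨x, hx, hw⟩ := hw
          refine Wins.intro (guardMove g h j z (fun k => (x k, j')) v.1)
            (hP.legal (Step.refl H _) rfl fun k => step_strongProd.mpr ⟨hx k, Or.inl (hk k)⟩)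
            fun v' hs hn => ?_
          have hP' := hL.guarded_guardMove rfl hP.above hs hn
          by_cases hv' : v'.2 = j'
          -- With Robert and the free cops all staying in row `j + 1`, a capture on `G` is a capture
          -- on `G ⊠ H`.
          · refine ihn _ _ hP' (fun k => rfl) (hw _ (step_strongProd.mp hs).1 fun hcap => hn ?_)
            rcases hcap with ⟨k, h1⟩ | ⟨hne, k, h1⟩
            · exact Or.inl ⟨.inr k, Prod.ext h1 hv'.symm⟩
            · refine Or.inr ⟨fun he => hne (congrArg Prod.fst he), .inr k, ?_⟩
              have h2 : c (.inr k) = ((c (.inr k)).1, j') := Prod.ext rfl (hk k)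
              have h3 : v = (v.1, j') := Prod.ext rfl hv
              have h4 : v' = (v'.1, j') := Prod.ext rfl hv'
              rw [h2, h3, h4]
              exact congrArg (Sym2.map fun a => (a, j')) h1
          · exact advance _ _ hP' (fun k => Or.inr rfl) hv'
        · exact advance c v hP (fun k => Or.inr (by rw [hk k])) hv
    refine Wins.intro (guardMove g h j z (fun k => ((c (.inr k)).1, j')) v.1)
      (hP.legal (Step.refl H _) rfl (hk' hk)) fun v' hs hn => ?_
    obtain ⟨n, hn'⟩ := hL.wins (fun k => (c (.inr k)).1) v'.1
    exact play n _ _ (hL.guarded_guardMove rfl hP.above hs hn) (fun k => rfl) hn'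

theorem Layout.wins_of_aligned [Finite V] (hL : Layout G H g h κ) {z : Fin L} (hz : z.val = 0)
    {c : (Q ⊕ R) ⊕ κ → V × Fin L} {v : V × Fin L} (hc : ∀ k, (c k).2 = z)
    (hq : ∀ q, Step G (c (.inl q)).1 (Sum.elim g h q v.1)) : Wins (G ⊠ H) c v := by
  refine Wins.intro (guardMove g h z z (fun k => c (.inr k)) v.1) ?_ fun v' hs hn => ?_
  · rintro ((q | q) | k)
    · exact step_strongProd.mpr ⟨hq (.inl q), Or.inl (hc _)⟩
    · exact step_strongProd.mpr ⟨hq (.inr q), Or.inl (hc _)⟩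
    · exact Step.refl _ _
  · rw [step_strongProd] at hs
    refine hL.wins_of_guarded _ z _ _ le_rfl ⟨fun q => ⟨hL.equivariant_lower q _ _ hs.1, rfl⟩,
      fun q => ⟨hL.equivariant_wall q _ _ hs.1, hz⟩, ?_⟩ fun k => Or.inl (hc _)
    have h1 : v'.2 ≠ z := fun he => by
      obtain ⟨q, hq⟩ := hL.covers_lower _ _ hs.1
      exact hn (Or.inl ⟨.inl (.inl q), Prod.ext hq he.symm⟩)
    rw [ne_eq, Fin.ext_iff] at h1
    rw [Fin.lt_def]
    omega

/-- The cops bring the guards onto the shadows one after the other: the cops that are to stay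
without a shadow play on `G` against a shadow that is still free, and the one who catches it
becomes its guard. -/
theorem Layout.wins_of_row_zero [Finite V] [Fintype Q] [Fintype R] (hL : Layout G H g h κ)
    {z : Fin L} (hz : z.val = 0) (d : ℕ) : ∀ (T : Finset (Q ⊕ R))
    (c : (Q ⊕ R) ⊕ κ → V × Fin L) (v : V × Fin L), Fintype.card (Q ⊕ R) ≤ T.card + d →
    (∀ k, (c k).2 = z) → (∀ q ∈ T, Step G (c (.inl q)).1 (Sum.elim g h q v.1)) →
    Wins (G ⊠ H) c v := by
  classical
  have hequi : Equivariant G (Sum.elim g h) := by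
    rintro (q | q)
    · exact hL.equivariant_lower q
    · exact hL.equivariant_wall q
  induction d with
  | zero =>
    intro T c v hT hc hq
    have hT' : T = Finset.univ :=
      Finset.eq_univ_of_card T (le_antisymm (Finset.card_le_univ T) hT)
    exact hL.wins_of_aligned hz hc fun q => hq q (hT' ▸ Finset.mem_univ q)
  | succ d ih =>
    intro T c v hT hc hq
    by_cases hT' : T = Finset.univ
    · exact hL.wins_of_aligned hz hc fun q => hq q (hT' ▸ Finset.mem_univ q)
    obtain ⟨p, hp⟩ : ∃ p, p ∉ T := by
      by_contra! hall
      exact hT' (Finset.eq_univ_of_forall hall)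
    have play : ∀ (n : ℕ) (c : (Q ⊕ R) ⊕ κ → V × Fin L) (v : V × Fin L), (∀ k, (c k).2 = z) →
        (∀ q ∈ T, Step G (c (.inl q)).1 (Sum.elim g h q v.1)) →
        WinsIn G n (fun k => (c (.inr k)).1) (Sum.elim g h p v.1) → Wins (G ⊠ H) c v := by
      intro n
      induction n with
      | zero => exact fun c v _ _ hw => hw.elim
      | succ n ihn =>
        rintro c v hc hq ⟨x, hx, hw⟩
        let c' : (Q ⊕ R) ⊕ κ → V × Fin L := Sum.elim
          (fun q => (if q ∈ T then Sum.elim g h q v.1 else (c (.inl q)).1, z)) fun k => (x k, z)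
        refine Wins.intro c' ?_ fun v' hs _ => ?_
        · rintro (q | k)
          · refine step_strongProd.mpr ⟨?_, Or.inl (hc _)⟩
            by_cases hqT : q ∈ T
            · simpa [c', hqT] using hq q hqT
            · simpa [c', hqT] using Step.refl G _
          · exact step_strongProd.mpr ⟨hx k, Or.inl (hc _)⟩
        · rw [step_strongProd] at hs
          have hc' : ∀ k, (c' k).2 = z := by
            rintro (q | k) <;> rfl
          have hq' : ∀ q ∈ T, Step G (c' (.inl q)).1 (Sum.elim g h q v'.1) := fun q hqT => by
            simpa [c', hqT] using hequi q _ _ hs.1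
          by_cases hcap : Caught (fun k => (c (.inr k)).1) x (Sum.elim g h p v.1)
            (Sum.elim g h p v'.1)
          · obtain ⟨k, hk⟩ := hcap.exists_step (hequi p _ _ hs.1)
            -- The catcher `k` exchanges roles with the cop in slot `p`, so the free team keeps its
            -- size.
            refine Wins.reindex (Equiv.swap (.inl p) (.inr k)) (ih (insert p T) _ _ ?_
              (fun _ => hc' _) fun q hqT => ?_)
            · rw [Finset.card_insert_of_notMem hp]
              omega
            · by_cases hqp : q = p
              · subst hqp
                rw [Function.comp_apply, Equiv.swap_apply_left]
                exact hk
              · rw [Function.comp_apply, Equiv.swap_apply_of_ne_of_ne (by simpa using hqp)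
                  (by simp)]
                exact hq' q (Finset.mem_of_mem_insert_of_ne hqT hqp)
          · exact ihn c' v' hc' hq' (hw _ (hequi p _ _ hs.1) hcap)
    obtain ⟨n, hn⟩ := hL.wins (fun k => (c (.inr k)).1) (Sum.elim g h p v.1)
    exact play n c v hc hq hn

theorem Layout.exists_isWinning [Finite V] [Nonempty V] [Fintype Q] [Fintype R] [Fintype κ]
    (hL : Layout G H g h κ) (hpos : 0 < L) {k : ℕ}
    (hk : Fintype.card Q + Fintype.card R + Fintype.card κ = k) :
    ∃ S : CopStrategy (G ⊠ H) k, S.IsWinning := by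
  refine exists_isWinning_of_card (ι := (Q ⊕ R) ⊕ κ) (by simpa using hk)
    (fun _ => (Classical.arbitrary V, ⟨0, hpos⟩)) fun v => ?_
  exact hL.wins_of_row_zero rfl (Fintype.card (Q ⊕ R)) ∅ _ v (by simp) (fun _ => rfl) (by simp)

end Product

/-! ### Neighbourhoods and shadows for the factors -/

section Factors

variable {V : Type*} {G : SimpleGraph V}

theorem closedNbhdCard_of_forall_step [Fintype V] (hG : ∀ u v, Step G u v) :
    ClosedNbhdCard G (Fintype.card V) :=
  fun v => ⟨Finset.univ, le_rfl, fun x _ => hG v x⟩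

theorem step_completeGraph (u v : V) : Step (SimpleGraph.completeGraph V) u v := by
  by_cases huv : u = v
  · exact Or.inl huv
  · exact Or.inr huv

theorem closedNbhdCard_cycleGraph (n : ℕ) :
    ClosedNbhdCard (SimpleGraph.cycleGraph (n + 3)) 3 := by
  intro v
  refine ⟨{v, v + 1, v - 1}, ?_, fun x hx => ?_⟩
  · rw [Finset.card_eq_three.mpr ⟨v, v + 1, v - 1, ?_, ?_, ?_, rfl⟩]
    · simp
    · rw [ne_eq, eq_sub_iff_add_eq, add_eq_left]
      simp
    · rw [ne_eq, eq_sub_iff_add_eq, add_assoc, add_eq_left, Fin.ext_iff, Fin.val_add]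
      simp [Nat.mod_eq_of_lt (show 2 < n + 3 by omega)]
  · simp only [Finset.mem_insert, Finset.mem_singleton] at hx
    rcases hx with rfl | rfl | rfl
    · exact Step.refl _ _
    · exact Or.inr (SimpleGraph.cycleGraph_adj.mpr (Or.inr (by simp)))
    · exact Or.inr (SimpleGraph.cycleGraph_adj.mpr (Or.inl (by simp)))

theorem closedNbhdCard_pathGraph {s : ℕ} (hs : 2 ≤ s) :
    ClosedNbhdCard (SimpleGraph.pathGraph s) 2 := by
  intro v
  obtain ⟨w, hw⟩ : ∃ w, (SimpleGraph.pathGraph s).Adj v w := by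
    have hv := v.isLt
    by_cases h0 : v.val = 0
    · exact ⟨⟨1, by omega⟩, SimpleGraph.pathGraph_adj.mpr (Or.inl (by simp [h0]))⟩
    · exact ⟨⟨v.val - 1, by omega⟩,
        SimpleGraph.pathGraph_adj.mpr (Or.inr (Nat.sub_add_cancel (by omega)))⟩
  refine ⟨{v, w}, (Finset.card_pair hw.ne).ge, fun x hx => ?_⟩
  rw [Finset.mem_insert, Finset.mem_singleton] at hx
  rcases hx with rfl | rfl
  · exact Step.refl _ _
  · exact Or.inr hw

/-- The vertices at distance at most one, as shadows of a vertex of a cycle. -/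
def cycleShadow (n : ℕ) (q : Fin 3) (a : Fin (n + 3)) : Fin (n + 3) := a + ![0, 1, -1] q

theorem equivariant_cycleShadow (n : ℕ) :
    Equivariant (SimpleGraph.cycleGraph (n + 3)) (cycleShadow n) := by
  rintro q a a' (rfl | h)
  · exact Step.refl _ _
  · refine Or.inr ?_
    rw [SimpleGraph.cycleGraph_adj] at h ⊢
    simpa [cycleShadow] using h

theorem covers_cycleShadow (n : ℕ) :
    Covers (SimpleGraph.cycleGraph (n + 3)) (cycleShadow n) := by
  rintro a a' (rfl | h)
  · exact ⟨0, by simp [cycleShadow]⟩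
  · rw [SimpleGraph.cycleGraph_adj] at h
    rcases h with h | h
    · exact ⟨2, by simp [cycleShadow, ← h]⟩
    · exact ⟨1, by simp [cycleShadow, ← h]⟩

/-- For complete graphs the shadows can stand still, one on each vertex. -/
theorem equivariant_const : Equivariant G (fun q _ : V => q) := fun q _ _ _ => Step.refl G q

theorem covers_const : Covers G (fun q _ : V => q) := fun _ a' _ => ⟨a', rfl⟩

variable {Q κ : Type*} {g : Q → V → V}

theorem layout_pathGraph (s : ℕ) (hw : ∀ (c : κ → V) v, Wins G c v) (hg : Equivariant G g)
    (hc : Covers G g) : Layout G (SimpleGraph.pathGraph s) g (fun q : Empty => q.elim) κ where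
  wins := hw
  equivariant_lower := hg
  equivariant_wall q := q.elim
  covers_lower := hc
  step_succ i j hij := Or.inr (SimpleGraph.pathGraph_adj.mpr (Or.inl hij))
  step_imp i j hij := by
    left
    rw [Step, SimpleGraph.pathGraph_adj, Fin.ext_iff] at hij
    omega

/-- The closing edge of the cycle ends at 0, so guarding row 0 with the same shadows disables it. -/
theorem layout_cycleGraph (m : ℕ) (hw : ∀ (c : κ → V) v, Wins G c v) (hg : Equivariant G g)
    (hc : Covers G g) : Layout G (SimpleGraph.cycleGraph (m + 3)) g g κ where
  wins := hw
  equivariant_lower := hg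
  equivariant_wall := hg
  covers_lower := hc
  step_succ i j hij := step_cycleGraph.mpr (Or.inr (Or.inl hij))
  step_imp i j hij := by
    rw [step_cycleGraph] at hij
    by_cases h0 : i.val = 0 ∨ j.val = 0
    · exact Or.inr ⟨h0, hc⟩
    · left
      omega

end Factors

end CheatingRobot

open CheatingRobot in
theorem mainTheorem7 (n m r s : ℕ) (hn : 3 ≤ n) (hm : 3 ≤ m) (hr : 2 ≤ r) (hs : 2 ≤ s) :
    CheatingRobot.cheatingRobotNumber
        (SimpleGraph.cycleGraph n ⊠ SimpleGraph.pathGraph s) = 5 ∧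
    CheatingRobot.cheatingRobotNumber
        (SimpleGraph.cycleGraph n ⊠ SimpleGraph.cycleGraph m) = 8 ∧
    CheatingRobot.cheatingRobotNumber
        (SimpleGraph.completeGraph (Fin r) ⊠ SimpleGraph.pathGraph s) = 2 * r - 1 ∧
    CheatingRobot.cheatingRobotNumber
        (SimpleGraph.completeGraph (Fin r) ⊠ SimpleGraph.cycleGraph m) = 3 * r - 1 ∧
    CheatingRobot.cheatingRobotNumber
        (SimpleGraph.completeGraph (Fin r) ⊠ SimpleGraph.completeGraph (Fin s)) = r * s - 1 := by
  obtain ⟨n, rfl⟩ := Nat.exists_eq_add_of_le' hn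
  obtain ⟨m, rfl⟩ := Nat.exists_eq_add_of_le' hm
  obtain ⟨r, rfl⟩ := Nat.exists_eq_add_of_le' hr
  obtain ⟨s, rfl⟩ := Nat.exists_eq_add_of_le' hs
  have hK : ∀ k, ClosedNbhdCard (SimpleGraph.completeGraph (Fin k)) k := fun k => by
    simpa using closedNbhdCard_of_forall_step (step_completeGraph (V := Fin k))
  have hP := closedNbhdCard_pathGraph hs
  have hC := closedNbhdCard_cycleGraph
  have hwK : ∀ (c : Fin (r + 1) → Fin (r + 2)) v, Wins (SimpleGraph.completeGraph _) c v :=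
    wins_of_forall_step step_completeGraph (by simp)
  refine ⟨cheatingRobotNumber_eq ((hC n).strongProd hP) ?_,
    cheatingRobotNumber_eq ((hC n).strongProd (hC m)) ?_, ?_, ?_,
    cheatingRobotNumber_eq ((hK _).strongProd (hK _)) ?_⟩
  · exact (layout_pathGraph _ wins_cycleGraph (equivariant_cycleShadow n)
      (covers_cycleShadow n)).exists_isWinning (by omega) (by simp)
  · exact (layout_cycleGraph m wins_cycleGraph (equivariant_cycleShadow n)
      (covers_cycleShadow n)).exists_isWinning (by omega) (by simp)
  · rw [mul_comm]
    refine cheatingRobotNumber_eq ((hK _).strongProd hP) ?_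
    exact (layout_pathGraph _ hwK equivariant_const covers_const).exists_isWinning (by omega)
      (by simp; omega)
  · rw [mul_comm]
    refine cheatingRobotNumber_eq ((hK _).strongProd (hC m)) ?_
    exact (layout_cycleGraph m hwK equivariant_const covers_const).exists_isWinning (by omega)
      (by simp; omega)
  · have hpos : 1 < (r + 2) * (s + 2) := by nlinarith
    have : Nonempty (Fin ((r + 2) * (s + 2) - 1)) := ⟨⟨0, by omega⟩⟩
    refine exists_isWinning (fun _ => (0, 0)) (wins_of_forall_step (fun p q =>
      step_strongProd.mpr ⟨step_completeGraph _ _, step_completeGraph _ _⟩) ?_ _)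
    rw [Fintype.card_fin, Fintype.card_prod, Fintype.card_fin, Fintype.card_fin]
    omega
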